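/- A *locally $C^*$-algebra* is a complete Hausdorff complex topological $*$-algebra $A$ (not necessarily unital) whose topology is determined by the set $S(A)$ of its continuous $C^*$-seminorms: a net converges to $0$ in $A$ if and only if $p$ tends to $0$ along it for every $p\in S(A)$. A *Hilbert $A$-module* is a complex vector space $E$ that is also a right $A$-module, compatibly with the complex algebra structure, with an $A$-valued inner product $\langle\cdot,\cdot\rangle$, $\mathbb C$- and $A$-linear in its second variable, such that $\langle\xi,\eta\rangle^*=\langle\eta,\xi\rangle$, $\langle\xi,\xi\rangle\ge 0$, and $\langle\xi,\xi\rangle=0$ only for $\xi=0$, and that is complete for the topology given by the seminorms $\xi\mapsto\sqrt{p(\langle\xi,\xi\rangle)}$, $p\in S(A)$. In particular $A$ is a Hilbert $A$-module with $\langle a,b\rangle=a^*b$. Write $L_A(E,F)$ for the set of adjointable $A$-module morphisms $T:E\to F$, that is, those for which there is an $A$-module morphism $T^*:F\to E$ with $\langle T\xi,\eta\rangle=\langle\xi,T^*\eta\rangle$ for all $\xi\in E,\ \eta\in F$. Two modules $E$ and $F$ are *unitarily equivalent* if there is $U\in L_A(E,F)$ with $U^*U=\mathrm{id}_E$ and $UU^*=\mathrm{id}_F$;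 the same terms are used over $M(A)$. Let $M(A)$ be the multiplier algebra of $A$: the pairs $(l,r)$ of linear maps $A\to A$ with $l(ab)=l(a)b$, $r(ab)=a\,r(b)$ and $a\,l(b)=r(a)\,b$ for all $a,b\in A$, with the product $(l,r)(l',r')=(l\circ l',r'\circ r)$ and the involution $(l,r)^*=(a\mapsto r(a^*)^*,\ a\mapsto l(a^*)^*)$; it is identified with $L_A(A,A)$ by $(l,r)\mapsto l$. The *multiplier module* of $E$ is $M(E)=L_A(A,E)$, a Hilbert $M(A)$-module with the action $t\cdot m=t\circ m$ and the inner product $\langle s,t\rangle=s^*\circ t$. **Corollary 4.2.** Let $A$ be a locally $C^*$-algebra and let $E$ and $F$ be two Hilbert $A$-modules. Then $E$ and $F$ are unitarily equivalent (as Hilbert $A$-modules) if and only if $M(E)$ and $M(F)$ are unitarily equivalent as Hilbert $M(A)$-modules. -/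

import Mathlib

open Topology Filter
open scoped RightActions

namespace LocCStar

universe u v w x

/-! ### Locally C⋆-algebras -/

/-- A C⋆-seminorm on a complex `*`-algebra: a submultiplicative seminorm with
`p (a⋆ a) = p a ^ 2`. -/
structure CStarSeminorm (A : Type u) [NonUnitalRing A] [StarRing A] [Module ℂ A] extends
    Seminorm ℂ A where
  mul_le' : ∀ a b : A, toFun (a * b) ≤ toFun a * toFun b
  star_mul_self' : ∀ a : A, toFun (star a * a) = toFun a ^ 2

/-- `S(A)`: the continuous C⋆-seminorms on `A`. -/
def ContCStarSeminorm (A : Type u) [NonUnitalRing A] [StarRing A] [Module ℂ A]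
    [TopologicalSpace A] : Type u :=
  {p : CStarSeminorm A // Continuous p.toSeminorm}

/-- The seminorm underlying an element of `S(A)`. -/
def ContCStarSeminorm.sn {A : Type u} [NonUnitalRing A] [StarRing A] [Module ℂ A]
    [TopologicalSpace A] (p : ContCStarSeminorm A) : Seminorm ℂ A :=
  p.1.toSeminorm

/-- A locally C⋆-algebra: a complete Hausdorff complex topological `*`-algebra (not necessarily
unital) whose topology is determined by its continuous C⋆-seminorms. -/
class LocallyCStarAlgebra (A : Type u) extends NonUnitalRing A, StarRing A, Module ℂ A,
    IsScalarTower ℂ A A, SMulCommClass ℂ A A, StarModule ℂ A,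
    UniformSpace A, IsUniformAddGroup A, ContinuousMul A, ContinuousStar A, ContinuousSMul ℂ A,
    T2Space A, CompleteSpace A where
  /-- A filter (or net) converges to `0` iff all continuous C⋆-seminorms tend to `0` along it. -/
  tendsto_zero_iff : ∀ l : Filter A,
    l ≤ 𝓝 0 ↔ ∀ p : ContCStarSeminorm A, Tendsto (fun a => p.sn a) l (𝓝 0)

/-! ### Modules with an algebra-valued inner product -/

/-- A complex vector space `E` that is a right `A`-module (`ξ <• a` is `ξ a`), compatibly with
the complex algebra structure of `A`, with an `A`-valued hermitian definite form, `ℂ`- and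
`A`-linear in its second variable. Positivity and completeness are added in `PreHilbertModule` and
`HilbertModule`; adjoints and unitaries do not involve them. -/
class InnerModule (A : Type u) (E : Type v) [NonUnitalRing A] [StarRing A] [Module ℂ A]
    [AddCommGroup E] [Module ℂ E] extends SMul Aᵐᵒᵖ E, Inner A E where
  add_rsmul : ∀ (ξ η : E) (a : A), (ξ + η) <• a = ξ <• a + η <• a
  rsmul_add : ∀ (ξ : E) (a b : A), ξ <• (a + b) = ξ <• a + ξ <• b
  rsmul_mul : ∀ (ξ : E) (a b : A), ξ <• (a * b) = (ξ <• a) <• b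
  smul_rsmul : ∀ (z : ℂ) (ξ : E) (a : A), (z • ξ) <• a = z • (ξ <• a)
  rsmul_smul : ∀ (z : ℂ) (ξ : E) (a : A), ξ <• (z • a) = z • (ξ <• a)
  inner_add_right : ∀ ξ η ζ : E, inner ξ (η + ζ) = inner ξ η + inner ξ ζ
  inner_smul_right : ∀ (z : ℂ) (ξ η : E), inner ξ (z • η) = z • inner ξ η
  inner_rsmul_right : ∀ (ξ η : E) (a : A), inner ξ (η <• a) = inner ξ η * a
  star_inner : ∀ ξ η : E, star (inner ξ η) = inner η ξ
  inner_self_eq_zero : ∀ ξ : E, inner ξ ξ = 0 ↔ ξ = 0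

/-- A pre-Hilbert `A`-module: moreover `⟨ξ, ξ⟩ ≥ 0`, where the positive elements of a (locally)
C⋆-algebra are those of the form `b⋆ b`. -/
class PreHilbertModule (A : Type u) (E : Type v) [LocallyCStarAlgebra A]
    [AddCommGroup E] [Module ℂ E] extends InnerModule A E where
  inner_self_nonneg : ∀ ξ : E, ∃ b : A, inner ξ ξ = star b * b

/-- The seminorm `ξ ↦ √ p(⟨ξ, ξ⟩)` on a pre-Hilbert module. -/
noncomputable def modSeminorm {A : Type u} {E : Type v} [LocallyCStarAlgebra A]
    [AddCommGroup E] [Module ℂ E] [PreHilbertModule A E] (p : ContCStarSeminorm A) (ξ : E) : ℝ :=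
  Real.sqrt (p.sn (inner A ξ ξ))

/-- A Hilbert `A`-module: a pre-Hilbert `A`-module that is complete for the topology given by the
seminorms `ξ ↦ √ p(⟨ξ, ξ⟩)`, `p ∈ S(A)`: every Cauchy filter converges. -/
class HilbertModule (A : Type u) (E : Type v) [LocallyCStarAlgebra A]
    [AddCommGroup E] [Module ℂ E] extends PreHilbertModule A E where
  complete : ∀ l : Filter E, l.NeBot →
    (∀ p : ContCStarSeminorm A,
      Tendsto (fun z : E × E => modSeminorm p (z.1 - z.2)) (l ×ˢ l) (𝓝 0)) →
    ∃ ξ : E, ∀ p : ContCStarSeminorm A, Tendsto (fun η : E => modSeminorm p (η - ξ)) l (𝓝 0)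

namespace InnerModule

variable {A : Type u} {E : Type v} [NonUnitalRing A] [StarRing A] [Module ℂ A]
  [AddCommGroup E] [Module ℂ E] [InnerModule A E]

theorem inner_add_left (ξ η ζ : E) : inner A (ξ + η) ζ = inner A ξ ζ + inner A η ζ := by
  rw [← star_inner, inner_add_right, star_add, star_inner, star_inner]

theorem inner_rsmul_left (ξ η : E) (a : A) : inner A (ξ <• a) η = star a * inner A ξ η := by
  rw [← star_inner, inner_rsmul_right, star_mul, star_inner]

theorem inner_smul_left [StarModule ℂ A] (z : ℂ) (ξ η : E) :
    inner A (z • ξ) η = star z • inner A ξ η := by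
  rw [← star_inner, inner_smul_right, star_smul, star_inner]

theorem inner_neg_right (ξ η : E) : inner A ξ (-η) = - inner A ξ η := by
  rw [← neg_one_smul ℂ η, inner_smul_right, neg_one_smul]

theorem inner_sub_right (ξ η ζ : E) : inner A ξ (η - ζ) = inner A ξ η - inner A ξ ζ := by
  rw [sub_eq_add_neg, inner_add_right, inner_neg_right, sub_eq_add_neg]

theorem ext_inner {η ζ : E} (h : ∀ ξ : E, inner A ξ η = inner A ξ ζ) : η = ζ := by
  rw [← sub_eq_zero, ← inner_self_eq_zero (A := A), inner_sub_right, h, sub_self]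

end InnerModule

/-! ### Adjointable operators -/

/-- `S` is an adjoint of `T`: both are `A`-module morphisms and `⟨T ξ, η⟩ = ⟨ξ, S η⟩`. -/
structure IsAdjointPair (A : Type u) {E : Type v} {F : Type w} [NonUnitalRing A] [StarRing A]
    [Module ℂ A] [AddCommGroup E] [Module ℂ E] [InnerModule A E]
    [AddCommGroup F] [Module ℂ F] [InnerModule A F] (T : E →ₗ[ℂ] F) (S : F →ₗ[ℂ] E) : Prop where
  map_rsmul : ∀ (ξ : E) (a : A), T (ξ <• a) = T ξ <• a
  map_rsmul' : ∀ (η : F) (a : A), S (η <• a) = S η <• a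
  inner_eq : ∀ (ξ : E) (η : F), inner A (T ξ) η = inner A ξ (S η)

/-- `L_A(E, F)`: the adjointable `A`-module morphisms from `E` to `F`. -/
structure Adjointable (A : Type u) (E : Type v) (F : Type w) [NonUnitalRing A] [StarRing A]
    [Module ℂ A] [AddCommGroup E] [Module ℂ E] [InnerModule A E]
    [AddCommGroup F] [Module ℂ F] [InnerModule A F] where
  toLin : E →ₗ[ℂ] F
  exists_adjoint : ∃ S : F →ₗ[ℂ] E, IsAdjointPair A toLin S

namespace Adjointable

variable {A : Type u} {E : Type v} {F : Type w} {G : Type x} [NonUnitalRing A] [StarRing A]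
  [Module ℂ A] [AddCommGroup E] [Module ℂ E] [InnerModule A E]
  [AddCommGroup F] [Module ℂ F] [InnerModule A F]
  [AddCommGroup G] [Module ℂ G] [InnerModule A G]

theorem toLin_injective : Function.Injective (toLin : Adjointable A E F → (E →ₗ[ℂ] F)) := by
  rintro ⟨T, _⟩ ⟨S, _⟩ h
  cases h
  rfl

theorem ext_apply {T S : Adjointable A E F} (h : ∀ ξ, T.toLin ξ = S.toLin ξ) : T = S :=
  toLin_injective (LinearMap.ext h)

theorem isAdjointPair_symm {T : E →ₗ[ℂ] F} {S : F →ₗ[ℂ] E} (h : IsAdjointPair A T S) :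
    IsAdjointPair A S T :=
  ⟨h.map_rsmul', h.map_rsmul, fun η ξ => by
    rw [← InnerModule.star_inner, ← h.inner_eq, InnerModule.star_inner]⟩

/-- The adjoint `T⋆` (it is unique, see `adjoint_eq`). -/
noncomputable def adjoint (T : Adjointable A E F) : Adjointable A F E :=
  ⟨T.exists_adjoint.choose, T.toLin, isAdjointPair_symm T.exists_adjoint.choose_spec⟩

theorem isAdjointPair (T : Adjointable A E F) : IsAdjointPair A T.toLin T.adjoint.toLin :=
  T.exists_adjoint.choose_spec

theorem map_rsmul (T : Adjointable A E F) (ξ : E) (a : A) :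
    T.toLin (ξ <• a) = T.toLin ξ <• a :=
  T.isAdjointPair.map_rsmul ξ a

theorem inner_toLin (T : Adjointable A E F) (ξ : E) (η : F) :
    inner A (T.toLin ξ) η = inner A ξ (T.adjoint.toLin η) :=
  T.isAdjointPair.inner_eq ξ η

theorem inner_adjoint (T : Adjointable A E F) (η : F) (ξ : E) :
    inner A (T.adjoint.toLin η) ξ = inner A η (T.toLin ξ) :=
  (isAdjointPair_symm T.isAdjointPair).inner_eq η ξ

theorem adjoint_eq {T : Adjointable A E F} {S : Adjointable A F E}
    (h : ∀ ξ η, inner A (T.toLin ξ) η = inner A ξ (S.toLin η)) : T.adjoint = S :=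
  ext_apply fun η => InnerModule.ext_inner (A := A) fun ξ => by rw [← inner_toLin, h]

theorem adjoint_adjoint (T : Adjointable A E F) : T.adjoint.adjoint = T :=
  adjoint_eq fun η ξ => inner_adjoint T η ξ

/-- The identity operator. -/
def id (A : Type u) (E : Type v) [NonUnitalRing A] [StarRing A] [Module ℂ A] [AddCommGroup E]
    [Module ℂ E] [InnerModule A E] : Adjointable A E E :=
  ⟨LinearMap.id, LinearMap.id, ⟨fun _ _ => rfl, fun _ _ => rfl, fun _ _ => rfl⟩⟩

/-- Composition `T ∘ S`. -/
def comp (T : Adjointable A F G) (S : Adjointable A E F) : Adjointable A E G :=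
  ⟨T.toLin ∘ₗ S.toLin, S.adjoint.toLin ∘ₗ T.adjoint.toLin,
    ⟨fun ξ a => by simp [map_rsmul], fun ξ a => by simp [map_rsmul],
      fun ξ η => by simp [inner_toLin]⟩⟩

@[simp] theorem comp_apply (T : Adjointable A F G) (S : Adjointable A E F) (ξ : E) :
    (T.comp S).toLin ξ = T.toLin (S.toLin ξ) := rfl

@[simp] theorem id_apply (ξ : E) : (Adjointable.id A E).toLin ξ = ξ := rfl

theorem adjoint_comp (T : Adjointable A F G) (S : Adjointable A E F) :
    (T.comp S).adjoint = S.adjoint.comp T.adjoint :=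
  adjoint_eq fun ξ η => by simp [inner_toLin]

/-! The vector space structure of `L_A(E, F)`, with pointwise operations. -/

instance : Zero (Adjointable A E F) :=
  ⟨⟨0, 0, ⟨fun ξ a => by
      have h := InnerModule.smul_rsmul (0 : ℂ) (0 : F) a
      simpa using h.symm, fun ξ a => by
      have h := InnerModule.smul_rsmul (0 : ℂ) (0 : E) a
      simpa using h.symm, fun ξ η => by
      have h := InnerModule.inner_smul_right (A := A) (0 : ℂ) η (0 : F)
      have h' := InnerModule.inner_smul_right (A := A) (0 : ℂ) ξ (0 : E)
      simp only [zero_smul] at h h'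
      rw [LinearMap.zero_apply, LinearMap.zero_apply, h', ← InnerModule.star_inner, h,
        star_zero]⟩⟩⟩

instance : Add (Adjointable A E F) :=
  ⟨fun T S => ⟨T.toLin + S.toLin, T.adjoint.toLin + S.adjoint.toLin,
    ⟨fun ξ a => by simp [map_rsmul, InnerModule.add_rsmul],
      fun ξ a => by simp [map_rsmul, InnerModule.add_rsmul],
      fun ξ η => by
        simp [InnerModule.inner_add_left, InnerModule.inner_add_right, inner_toLin]⟩⟩⟩

variable [StarModule ℂ A]

instance : SMul ℂ (Adjointable A E F) :=
  ⟨fun z T => ⟨z • T.toLin, star z • T.adjoint.toLin,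
    ⟨fun ξ a => by simp [map_rsmul, InnerModule.smul_rsmul],
      fun ξ a => by simp [map_rsmul, InnerModule.smul_rsmul],
      fun ξ η => by
        simp only [LinearMap.smul_apply]
        rw [InnerModule.inner_smul_left, InnerModule.inner_smul_right, inner_toLin]⟩⟩⟩

instance : Neg (Adjointable A E F) := ⟨fun T => (-1 : ℂ) • T⟩

@[simp] theorem zero_apply (ξ : E) : (0 : Adjointable A E F).toLin ξ = 0 := rfl
@[simp] theorem add_apply (T S : Adjointable A E F) (ξ : E) :
    (T + S).toLin ξ = T.toLin ξ + S.toLin ξ := rfl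
@[simp] theorem smul_apply (z : ℂ) (T : Adjointable A E F) (ξ : E) :
    (z • T).toLin ξ = z • T.toLin ξ := rfl
@[simp] theorem neg_apply (T : Adjointable A E F) (ξ : E) :
    (-T).toLin ξ = - T.toLin ξ := neg_one_smul ℂ (T.toLin ξ)

instance : AddCommGroup (Adjointable A E F) where
  add_assoc T S R := ext_apply fun ξ => by simp [add_assoc]
  zero_add T := ext_apply fun ξ => by simp
  add_zero T := ext_apply fun ξ => by simp
  add_comm T S := ext_apply fun ξ => by simp [add_comm]
  neg_add_cancel T := ext_apply fun ξ => by simp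
  nsmul := nsmulRec
  zsmul := zsmulRec

instance : Module ℂ (Adjointable A E F) where
  one_smul T := ext_apply fun ξ => by simp
  mul_smul z z' T := ext_apply fun ξ => by simp [mul_smul]
  smul_zero z := ext_apply fun ξ => by simp
  smul_add z T S := ext_apply fun ξ => by simp
  add_smul z z' T := ext_apply fun ξ => by simp [add_smul]
  zero_smul T := ext_apply fun ξ => by simp

end Adjointable

/-- `E` and `F` are unitarily equivalent over `A`: there is `U ∈ L_A(E, F)` with
`U⋆ U = id` and `U U⋆ = id`. -/
def UnitarilyEquivalent (A : Type u) (E : Type v) (F : Type w) [NonUnitalRing A] [StarRing A]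
    [Module ℂ A] [AddCommGroup E] [Module ℂ E] [InnerModule A E]
    [AddCommGroup F] [Module ℂ F] [InnerModule A F] : Prop :=
  ∃ U : Adjointable A E F,
    U.adjoint.comp U = Adjointable.id A E ∧ U.comp U.adjoint = Adjointable.id A F

/-! ### The multiplier algebra -/

/-- `M(A)`: the multipliers of `A`, i.e. pairs `(l, r)` of linear maps from `A` to `A` with
`l (a b) = l a * b`, `r (a b) = a * r b` and `a * l b = r a * b`. -/
@[ext] structure Multiplier (A : Type u) [NonUnitalRing A] [Module ℂ A] where
  l : A →ₗ[ℂ] A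
  r : A →ₗ[ℂ] A
  l_mul : ∀ a b : A, l (a * b) = l a * b
  r_mul : ∀ a b : A, r (a * b) = a * r b
  mul_l : ∀ a b : A, a * l b = r a * b

namespace Multiplier

section Algebraic

variable {A : Type u} [NonUnitalRing A] [Module ℂ A]

theorem ext_apply {m n : Multiplier A} (hl : ∀ a, m.l a = n.l a) (hr : ∀ a, m.r a = n.r a) :
    m = n :=
  Multiplier.ext (LinearMap.ext hl) (LinearMap.ext hr)

instance : Zero (Multiplier A) := ⟨⟨0, 0, by simp, by simp, by simp⟩⟩
instance : One (Multiplier A) := ⟨⟨LinearMap.id, LinearMap.id, by simp, by simp, by simp⟩⟩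
instance : Add (Multiplier A) :=
  ⟨fun m n => ⟨m.l + n.l, m.r + n.r, by simp [l_mul, add_mul], by simp [r_mul, mul_add],
    by simp [mul_add, add_mul, mul_l]⟩⟩
instance : Neg (Multiplier A) :=
  ⟨fun m => ⟨-m.l, -m.r, by simp [l_mul], by simp [r_mul], by simp [mul_l]⟩⟩

/-- `(l, r) (l', r') = (l ∘ l', r' ∘ r)`. -/
instance : Mul (Multiplier A) :=
  ⟨fun m n => ⟨m.l ∘ₗ n.l, n.r ∘ₗ m.r, by simp [l_mul], by simp [r_mul], by simp [mul_l]⟩⟩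

@[simp] theorem zero_l (a : A) : (0 : Multiplier A).l a = 0 := rfl
@[simp] theorem zero_r (a : A) : (0 : Multiplier A).r a = 0 := rfl
@[simp] theorem one_l (a : A) : (1 : Multiplier A).l a = a := rfl
@[simp] theorem one_r (a : A) : (1 : Multiplier A).r a = a := rfl
@[simp] theorem add_l (m n : Multiplier A) (a : A) : (m + n).l a = m.l a + n.l a := rfl
@[simp] theorem add_r (m n : Multiplier A) (a : A) : (m + n).r a = m.r a + n.r a := rfl
@[simp] theorem neg_l (m : Multiplier A) (a : A) : (-m).l a = -m.l a := rfl
@[simp] theorem neg_r (m : Multiplier A) (a : A) : (-m).r a = -m.r a := rfl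
@[simp] theorem mul_l_apply (m n : Multiplier A) (a : A) : (m * n).l a = m.l (n.l a) := rfl
@[simp] theorem mul_r_apply (m n : Multiplier A) (a : A) : (m * n).r a = n.r (m.r a) := rfl

instance : Ring (Multiplier A) where
  add_assoc m n k := ext_apply (fun a => by simp [add_assoc]) (fun a => by simp [add_assoc])
  zero_add m := ext_apply (fun a => by simp) (fun a => by simp)
  add_zero m := ext_apply (fun a => by simp) (fun a => by simp)
  add_comm m n := ext_apply (fun a => by simp [add_comm]) (fun a => by simp [add_comm])
  neg_add_cancel m := ext_apply (fun a => by simp) (fun a => by simp)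
  mul_assoc m n k := ext_apply (fun a => by simp) (fun a => by simp)
  one_mul m := ext_apply (fun a => by simp) (fun a => by simp)
  mul_one m := ext_apply (fun a => by simp) (fun a => by simp)
  left_distrib m n k := ext_apply (fun a => by simp) (fun a => by simp)
  right_distrib m n k := ext_apply (fun a => by simp) (fun a => by simp)
  zero_mul m := ext_apply (fun a => by simp) (fun a => by simp)
  mul_zero m := ext_apply (fun a => by simp) (fun a => by simp)
  nsmul := nsmulRec
  zsmul := zsmulRec

variable [IsScalarTower ℂ A A] [SMulCommClass ℂ A A]

instance : SMul ℂ (Multiplier A) :=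
  ⟨fun z m => ⟨z • m.l, z • m.r, fun a b => by simp [l_mul, smul_mul_assoc],
    fun a b => by simp [r_mul, mul_smul_comm],
    fun a b => by simp [mul_smul_comm, smul_mul_assoc, mul_l]⟩⟩

@[simp] theorem smul_l (z : ℂ) (m : Multiplier A) (a : A) : (z • m).l a = z • m.l a := rfl
@[simp] theorem smul_r (z : ℂ) (m : Multiplier A) (a : A) : (z • m).r a = z • m.r a := rfl

instance : Module ℂ (Multiplier A) where
  one_smul m := ext_apply (fun a => by simp) (fun a => by simp)
  mul_smul z z' m := ext_apply (fun a => by simp [mul_smul]) (fun a => by simp [mul_smul])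
  smul_zero z := ext_apply (fun a => by simp) (fun a => by simp)
  smul_add z m n := ext_apply (fun a => by simp) (fun a => by simp)
  add_smul z z' m := ext_apply (fun a => by simp [add_smul]) (fun a => by simp [add_smul])
  zero_smul m := ext_apply (fun a => by simp) (fun a => by simp)

instance : IsScalarTower ℂ (Multiplier A) (Multiplier A) :=
  ⟨fun z m n => ext_apply (fun a => by simp) (fun a => by simp)⟩

instance : SMulCommClass ℂ (Multiplier A) (Multiplier A) :=
  ⟨fun z m n => ext_apply (fun a => by simp) (fun a => by simp)⟩

end Algebraic

section StarAlgebraic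

variable {A : Type u} [NonUnitalRing A] [StarRing A] [Module ℂ A] [StarModule ℂ A]

/-- For a linear map `f`, the linear map `a ↦ (f a⋆)⋆`. -/
def conj (f : A →ₗ[ℂ] A) : A →ₗ[ℂ] A where
  toFun a := star (f (star a))
  map_add' a b := by simp
  map_smul' z a := by simp

@[simp] theorem conj_apply (f : A →ₗ[ℂ] A) (a : A) : conj f a = star (f (star a)) := rfl

/-- `(l, r)⋆ = (a ↦ (r a⋆)⋆, a ↦ (l a⋆)⋆)`. -/
instance : Star (Multiplier A) :=
  ⟨fun m => ⟨conj m.r, conj m.l, fun a b => by simp [r_mul], fun a b => by simp [l_mul],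
    fun a b => by
      have h := congrArg star (m.mul_l (star b) (star a))
      simpa using h.symm⟩⟩

@[simp] theorem star_l (m : Multiplier A) (a : A) : (star m).l a = star (m.r (star a)) := rfl
@[simp] theorem star_r (m : Multiplier A) (a : A) : (star m).r a = star (m.l (star a)) := rfl

instance : StarRing (Multiplier A) where
  star_involutive m := ext_apply (fun a => by simp) (fun a => by simp)
  star_mul m n := ext_apply (fun a => by simp) (fun a => by simp)
  star_add m n := ext_apply (fun a => by simp) (fun a => by simp)

instance [IsScalarTower ℂ A A] [SMulCommClass ℂ A A] : StarModule ℂ (Multiplier A) :=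
  ⟨fun z m => ext_apply (fun a => by simp) (fun a => by simp)⟩

end StarAlgebraic

end Multiplier

/-! ### `A` as a module over itself -/

section Self

variable {A : Type u} [LocallyCStarAlgebra A]

theorem eq_zero_of_seminorms {a : A} (h : ∀ p : ContCStarSeminorm A, p.sn a = 0) : a = 0 := by
  have h1 : pure a ≤ 𝓝 (0 : A) :=
    (LocallyCStarAlgebra.tendsto_zero_iff (pure a)).2 fun p => by
      simpa [h p] using tendsto_pure_nhds (fun b : A => p.sn b) a
  exact (pure_le_nhds_iff).1 h1

theorem star_mul_self_eq_zero' {a : A} (h : star a * a = 0) : a = 0 :=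
  eq_zero_of_seminorms fun p => by
    have h1 : p.sn (star a * a) = p.sn a ^ 2 := p.1.star_mul_self' a
    rw [h, map_zero] at h1
    exact pow_eq_zero_iff (two_ne_zero) |>.1 h1.symm

/-- `A` with right multiplication and `⟨a, b⟩ = a⋆ b`. -/
instance : InnerModule A A where
  inner a b := star a * b
  add_rsmul a b c := add_mul a b c
  rsmul_add a b c := mul_add a b c
  rsmul_mul a b c := (mul_assoc a b c).symm
  smul_rsmul z a b := smul_mul_assoc z a b
  rsmul_smul z a b := mul_smul_comm z a b
  inner_add_right a b c := mul_add _ _ _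
  inner_smul_right z a b := mul_smul_comm _ _ _
  inner_rsmul_right a b c := (mul_assoc _ _ _).symm
  star_inner a b := by simp
  inner_self_eq_zero a := ⟨star_mul_self_eq_zero', fun h => by simp [h]⟩

theorem inner_self_def (a b : A) : inner A a b = star a * b := rfl

theorem rsmul_self_def (a b : A) : a <• b = a * b := rfl

end Self

/-! ### The identification of `M(A)` with `L_A(A)`, and the multiplier module -/

section MultiplierModule

variable {A : Type u} [LocallyCStarAlgebra A]

/-- The adjointable operator `l` on `A` given by a multiplier `(l, r)`. -/
def Multiplier.toAdjointable (m : Multiplier A) : Adjointable A A A :=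
  ⟨m.l, (star m).l, ⟨fun a b => m.l_mul a b, fun a b => (star m).l_mul a b, fun a b => by
    rw [inner_self_def, inner_self_def, (star m).mul_l]
    simp⟩⟩

/-- The multiplier `(T, a ↦ (T⋆ a⋆)⋆)` given by an adjointable operator `T` on `A`. -/
noncomputable def Adjointable.toMultiplier (T : Adjointable A A A) : Multiplier A :=
  ⟨T.toLin, Multiplier.conj T.adjoint.toLin, fun a b => T.map_rsmul a b,
    fun a b => by
      have h := T.adjoint.map_rsmul (star b) (star a)
      simp only [rsmul_self_def] at h
      simp [h],
    fun a b => by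
      have h := T.inner_adjoint (star a) b
      simp only [inner_self_def, star_star] at h
      simpa using h.symm⟩

@[simp] theorem Multiplier.toAdjointable_apply (m : Multiplier A) (a : A) :
    m.toAdjointable.toLin a = m.l a := rfl

@[simp] theorem Adjointable.toMultiplier_l (T : Adjointable A A A) (a : A) :
    T.toMultiplier.l a = T.toLin a := rfl

theorem Multiplier.ext_l {m n : Multiplier A} (h : ∀ a, m.l a = n.l a) : m = n :=
  Multiplier.ext_apply h fun a => by
    have h1 : ∀ b : A, (m.r a - n.r a) * b = 0 := fun b => by
      rw [sub_mul, ← m.mul_l, ← n.mul_l, h, sub_self]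
    have h2 : star (star (m.r a - n.r a)) * star (m.r a - n.r a) = 0 := by
      rw [star_star]; exact h1 _
    have h3 := star_mul_self_eq_zero' h2
    exact sub_eq_zero.1 (star_eq_zero.1 h3)

theorem Multiplier.toAdjointable_toMultiplier (m : Multiplier A) :
    m.toAdjointable.toMultiplier = m :=
  Multiplier.ext_l fun _ => rfl

theorem Adjointable.toMultiplier_toAdjointable (T : Adjointable A A A) :
    T.toMultiplier.toAdjointable = T :=
  Adjointable.ext_apply fun _ => rfl

theorem Adjointable.star_toMultiplier (T : Adjointable A A A) :
    star T.toMultiplier = T.adjoint.toMultiplier :=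
  Multiplier.ext_l fun a => by
    change star (star (T.adjoint.toLin (star (star a)))) = T.adjoint.toLin a
    simp

variable {E : Type v} [AddCommGroup E] [Module ℂ E] [InnerModule A E]

variable (A E) in
/-- The multiplier module `M(E) = L_A(A, E)`. -/
abbrev MultiplierModule : Type (max u v) := Adjointable A A E

/-- `M(E)` as a module over `M(A)`, identified with `L_A(A)`: the action is `t · m = t ∘ m` and
the inner product is `⟨s, t⟩ = s⋆ ∘ t`. -/
noncomputable instance : InnerModule (Multiplier A) (MultiplierModule A E) where
  smul m t := t.comp m.unop.toAdjointable
  inner s t := (s.adjoint.comp t).toMultiplier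
  add_rsmul s t m := Adjointable.ext_apply fun _ => rfl
  rsmul_add s m n := Adjointable.ext_apply fun a => map_add s.toLin (m.l a) (n.l a)
  rsmul_mul s m n := Adjointable.ext_apply fun _ => rfl
  smul_rsmul z s m := Adjointable.ext_apply fun _ => rfl
  rsmul_smul z s m := Adjointable.ext_apply fun a => map_smul s.toLin z (m.l a)
  inner_add_right s t k := Multiplier.ext_l fun a => map_add s.adjoint.toLin _ _
  inner_smul_right z s t := Multiplier.ext_l fun a => map_smul s.adjoint.toLin _ _
  inner_rsmul_right s t m := Multiplier.ext_l fun _ => rfl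
  star_inner s t := by
    rw [Adjointable.star_toMultiplier, Adjointable.adjoint_comp, Adjointable.adjoint_adjoint]
  inner_self_eq_zero s := by
    constructor
    · intro h
      refine Adjointable.ext_apply fun a => (InnerModule.inner_self_eq_zero (A := A) _).1 ?_
      have h1 : s.adjoint.toLin (s.toLin a) = 0 := congrArg (fun m => Multiplier.l m a) h
      rw [Adjointable.inner_toLin, h1, inner_self_def, mul_zero]
    · rintro rfl
      refine Multiplier.ext_l fun a => ?_
      change (Adjointable.adjoint 0).toLin 0 = 0
      exact map_zero _

theorem MultiplierModule.rsmul_apply (t : MultiplierModule A E) (m : Multiplier A) (a : A) :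
    (t <• m).toLin a = t.toLin (m.l a) := rfl

theorem MultiplierModule.inner_l (s t : MultiplierModule A E) (a : A) :
    (inner (Multiplier A) s t).l a = s.adjoint.toLin (t.toLin a) := rfl

end MultiplierModule

end LocCStar

namespace LocCStar

universe u v w

/-! ### The C⋆-algebra associated with a C⋆-seminorm -/

namespace CStarSeminorm

section Completion

variable {A : Type u} [NonUnitalRing A] [StarRing A] [Module ℂ A]

/-! A vector `ξ` of `E` acts as the operator `a ↦ ξ a` in `M(E)` (`ofVector`). This embeds `E` in
`M(E)`, and the inner product of two embedded vectors is left multiplication by `⟨ξ, η⟩`. A unitary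
`u : E → F` induces `t ↦ u ∘ t` on multiplier modules, which settles one direction.

For the converse, a unitary `v : M(E) → M(F)` must be shown to map vectors to vectors. Since `v`
preserves inner products, `t = v (ofVector ξ)` satisfies `⟨t, t⟩ = ⟨ofVector ξ, ofVector ξ⟩`, and
the crux is that such a `t` comes from `F` (`exists_eq_ofVector`). Indeed `ξ a ↦ t a` is isometric.
Along a filter of `e` in `A` with `ξ e → ξ`, the values `t e` are therefore Cauchy and converge to
some `η` by completeness of `F`. Then `t (e a) = (t e) a` tends both to `t a` and to `η a`. The
restrictions of `v` and `v⋆` to vectors are mutually adjoint and inverse.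

The filter comes from approximate units of the C⋆-algebras obtained by completing `A` for single
seminorms (`exists_approx_filter`). The estimates rest on monotonicity of the norm on positive
elements (`map_le_map_add`). -/

theorem map_star_mul_self (p : CStarSeminorm A) (a : A) :
    p.toSeminorm (star a * a) = p.toSeminorm a ^ 2 :=
  p.star_mul_self' a

theorem map_mul_le (p : CStarSeminorm A) (a b : A) :
    p.toSeminorm (a * b) ≤ p.toSeminorm a * p.toSeminorm b :=
  p.mul_le' a b

/-- Cancel `p a` in `p a ^ 2 = p (a⋆ a) ≤ p a⋆ * p a`. Applied to `a⋆` as well, this makes the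
involution isometric. -/
theorem le_map_star (p : CStarSeminorm A) (a : A) : p.toSeminorm a ≤ p.toSeminorm (star a) := by
  have h := p.map_mul_le (star a) a
  rw [map_star_mul_self, sq] at h
  by_cases ha : p.toSeminorm a = 0
  · rw [ha]; exact apply_nonneg _ _
  · exact le_of_mul_le_mul_right h ((apply_nonneg p.toSeminorm a).lt_of_ne' ha)

theorem apply_star (p : CStarSeminorm A) (a : A) : p.toSeminorm (star a) = p.toSeminorm a :=
  le_antisymm (by simpa using p.le_map_star (star a)) (p.le_map_star a)

/-- A copy of `A`, carrying the seminorm `p` as its norm. -/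
def Copy (_ : CStarSeminorm A) : Type u := A

namespace Copy

variable (p : CStarSeminorm A)

instance : NonUnitalRing p.Copy := inferInstanceAs (NonUnitalRing A)
instance : StarRing p.Copy := inferInstanceAs (StarRing A)
instance : Module ℂ p.Copy := inferInstanceAs (Module ℂ A)
instance [h : IsScalarTower ℂ A A] : IsScalarTower ℂ p.Copy p.Copy := h
instance [h : SMulCommClass ℂ A A] : SMulCommClass ℂ p.Copy p.Copy := h
instance [h : StarModule ℂ A] : StarModule ℂ p.Copy := h

noncomputable instance : SeminormedAddCommGroup p.Copy :=
  AddGroupSeminorm.toSeminormedAddCommGroup (E := p.Copy) p.toSeminorm.toAddGroupSeminorm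

noncomputable instance : NonUnitalSeminormedRing p.Copy where
  __ := (inferInstance : SeminormedAddCommGroup p.Copy)
  __ := (inferInstance : NonUnitalRing p.Copy)
  norm_mul_le := p.map_mul_le

noncomputable instance : NormedSpace ℂ p.Copy where
  __ := (inferInstance : Module ℂ p.Copy)
  norm_smul_le z a := (map_smul_eq_mul p.toSeminorm z (show A from a)).le

instance : NormedStarGroup p.Copy := ⟨fun a => (p.apply_star a).le⟩

theorem norm_star_mul_self (a : p.Copy) : ‖star a * a‖ = ‖a‖ * ‖a‖ :=
  (p.map_star_mul_self a).trans (sq _)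

end Copy

open UniformSpace UniformSpace.Completion

/-- The completion of `A` with respect to the seminorm `p`. -/
abbrev Compl (p : CStarSeminorm A) : Type u := Completion p.Copy

namespace Compl

variable (p : CStarSeminorm A)

noncomputable instance : Mul p.Compl :=
  ⟨Function.curry <| (isDenseInducing_coe.prodMap isDenseInducing_coe).extend
    ((↑) ∘ Function.uncurry ((· * ·) : p.Copy → p.Copy → p.Copy))⟩

theorem coe_mul (a b : p.Copy) : ((a * b : p.Copy) : p.Compl) = a * b :=
  ((isDenseInducing_coe.prodMap isDenseInducing_coe).extend_eq
    ((continuous_coe p.Copy).comp (continuous_mul (M := p.Copy))) (a, b)).symm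

/-- A continuous biadditive map extends continuously to completions. With this, each algebraic
identity below is a closed condition and needs checking only on the dense image of `A`. -/
instance : ContinuousMul p.Compl where
  continuous_mul := by
    let m := (AddMonoidHom.mul : p.Copy →+ p.Copy →+ p.Copy).compr₂ toCompl
    have : Continuous fun x : p.Copy × p.Copy => m x.1 x.2 :=
      (continuous_coe p.Copy).comp continuous_mul
    have di : IsDenseInducing (toCompl : p.Copy → p.Compl) := isDenseInducing_coe
    exact di.extend_Z_bilin di this

noncomputable instance : NonUnitalRing p.Compl :=
  { (inferInstance : AddCommGroup p.Compl), (inferInstance : Mul p.Compl) with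
    zero_mul a := Completion.induction_on a (isClosed_eq (by fun_prop) continuous_const)
      fun a => by rw [← coe_zero, ← coe_mul, zero_mul]
    mul_zero a := Completion.induction_on a (isClosed_eq (by fun_prop) continuous_const)
      fun a => by rw [← coe_zero, ← coe_mul, mul_zero]
    mul_assoc a b c := Completion.induction_on₃ a b c (isClosed_eq (by fun_prop) (by fun_prop))
      fun a b c => by rw [← coe_mul, ← coe_mul, ← coe_mul, ← coe_mul, mul_assoc]
    left_distrib a b c := Completion.induction_on₃ a b c (isClosed_eq (by fun_prop) (by fun_prop))
      fun a b c => by rw [← coe_add, ← coe_mul, ← coe_mul, ← coe_mul, ← coe_add, mul_add]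
    right_distrib a b c := Completion.induction_on₃ a b c (isClosed_eq (by fun_prop) (by fun_prop))
      fun a b c => by rw [← coe_add, ← coe_mul, ← coe_mul, ← coe_mul, ← coe_add, add_mul] }

noncomputable instance : NonUnitalNormedRing p.Compl where
  __ := (inferInstance : NormedAddCommGroup p.Compl)
  __ := (inferInstance : NonUnitalRing p.Compl)
  norm_mul_le x y := by
    induction x, y using induction_on₂ with
    | hp => apply isClosed_le <;> fun_prop
    | ih x y => simpa only [← coe_mul, norm_coe] using norm_mul_le x y

noncomputable instance : Star p.Compl := ⟨Completion.map star⟩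

theorem uniformContinuous_star : UniformContinuous (star : p.Copy → p.Copy) :=
  (AddMonoidHomClass.isometry_of_norm (starAddEquiv : p.Copy ≃+ p.Copy) norm_star).uniformContinuous

theorem coe_star (a : p.Copy) : ((star a : p.Copy) : p.Compl) = star (a : p.Compl) :=
  (Completion.map_coe (uniformContinuous_star p) a).symm

instance : ContinuousStar p.Compl := ⟨Completion.continuous_map⟩

noncomputable instance : StarRing p.Compl where
  star_involutive a := Completion.induction_on a (isClosed_eq (by fun_prop) (by fun_prop))
    fun a => by rw [← coe_star, ← coe_star, star_star]
  star_mul a b := Completion.induction_on₂ a b (isClosed_eq (by fun_prop) (by fun_prop))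
    fun a b => by rw [← coe_star, ← coe_star, ← coe_mul, ← coe_mul, ← coe_star, star_mul]
  star_add a b := Completion.induction_on₂ a b (isClosed_eq (by fun_prop) (by fun_prop))
    fun a b => by rw [← coe_star, ← coe_star, ← coe_add, ← coe_add, ← coe_star, star_add]

instance : CStarRing p.Compl where
  norm_mul_self_le a := Completion.induction_on a (isClosed_le (by fun_prop) (by fun_prop))
    fun a => by rw [← coe_star, ← coe_mul, norm_coe, norm_coe, Copy.norm_star_mul_self]

variable [IsScalarTower ℂ A A] [SMulCommClass ℂ A A] [StarModule ℂ A]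

instance : IsScalarTower ℂ p.Compl p.Compl where
  smul_assoc z a b := Completion.induction_on₂ a b
    (isClosed_eq ((continuous_fst.const_smul z).mul continuous_snd)
      ((continuous_fst.mul continuous_snd).const_smul z))
    fun a b => by
      rw [smul_eq_mul, smul_eq_mul, ← coe_smul, ← coe_mul, ← coe_mul, ← coe_smul, smul_mul_assoc]

instance : SMulCommClass ℂ p.Compl p.Compl where
  smul_comm z a b := Completion.induction_on₂ a b
    (isClosed_eq ((continuous_fst.mul continuous_snd).const_smul z)
      (continuous_fst.mul (continuous_snd.const_smul z)))
    fun a b => by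
      rw [smul_eq_mul, smul_eq_mul, ← coe_smul, ← coe_mul, ← coe_mul, ← coe_smul, mul_smul_comm]

instance : StarModule ℂ p.Compl where
  star_smul z a := Completion.induction_on a
    (isClosed_eq (continuous_id.const_smul z).star (continuous_id.star.const_smul (star z)))
    fun a => by
      change star (z • (a : p.Compl)) = star z • star (a : p.Compl)
      rw [← coe_smul, ← coe_star, ← coe_star, ← coe_smul, star_smul]

noncomputable instance : NonUnitalCStarAlgebra p.Compl where
  complete := CompleteSpace.complete

end Compl

/-! ### Positivity and approximate units, transferred from the C⋆-completion -/

variable [IsScalarTower ℂ A A] [SMulCommClass ℂ A A] [StarModule ℂ A]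

/-- Every C⋆-seminorm is the norm of a `*`-homomorphism with dense range into a C⋆-algebra. -/
theorem exists_starHom (p : CStarSeminorm A) :
    ∃ (B : Type u) (_ : NonUnitalCStarAlgebra B) (φ : A →⋆ₙₐ[ℂ] B),
      DenseRange φ ∧ ∀ a, ‖φ a‖ = p.toSeminorm a :=
  ⟨p.Compl, inferInstance,
    { toFun := fun a => ((show p.Copy from a : p.Copy) : p.Compl)
      map_smul' := fun z a => coe_smul (X := p.Copy) z a
      map_zero' := coe_zero
      map_add' := fun a b => coe_add (α := p.Copy) a b
      map_mul' := Compl.coe_mul p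
      map_star' := Compl.coe_star p },
    denseRange_coe (α := p.Copy), fun a => norm_coe (E := p.Copy) a⟩

/-- In the completion `0 ≤ x ≤ x + y` for positive `x` and `y`, and the norm of a C⋆-algebra is
monotone on positive elements. -/
theorem map_le_map_add (p : CStarSeminorm A) (a b : A) :
    p.toSeminorm (star a * a) ≤ p.toSeminorm (star a * a + star b * b) := by
  obtain ⟨B, _, φ, -, hφ⟩ := p.exists_starHom
  let _ := CStarAlgebra.spectralOrder B
  have _ := CStarAlgebra.spectralOrderedRing B
  rw [← hφ, ← hφ, map_add]
  simp only [map_mul, map_star]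
  exact CStarAlgebra.norm_le_norm_of_nonneg_of_le (star_mul_self_nonneg (φ a))
    (le_add_of_nonneg_right (star_mul_self_nonneg (φ b)))

/-- For `h = ⟨ξ, ξ⟩` the displayed element is `⟨ξ e - ξ, ξ e - ξ⟩`. -/
theorem exists_approx_unit (p : CStarSeminorm A) (h : A) {ε : ℝ} (hε : 0 < ε) :
    ∃ e : A, p.toSeminorm (star e * (h * e) - star e * h - (h * e - h)) < ε := by
  obtain ⟨B, _, φ, hd, hφ⟩ := p.exists_starHom
  let _ := CStarAlgebra.spectralOrder B
  have _ := CStarAlgebra.spectralOrderedRing B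
  have hl := CStarAlgebra.increasingApproximateUnit B
  -- The target expression is `x⋆ (h x - h) - (h x - h)`. Since `‖x‖ ≤ 1`, each of the two terms is
  -- at most `‖h x - h‖`, whence the doubled norm.
  have h1 : Tendsto (fun x : B => ‖φ h * x - φ h‖ + ‖φ h * x - φ h‖)
      (CStarAlgebra.approximateUnit B) (𝓝 0) := by
    have := (hl.tendsto_mul_left (φ h)).sub_const (φ h) |>.norm
    simpa using this.add this
  obtain ⟨x, hx, hx1⟩ := ((h1.eventually (gt_mem_nhds hε)).and hl.eventually_norm).exists
  have hc : Continuous fun x : B => ‖star x * (φ h * x) - star x * φ h - (φ h * x - φ h)‖ := by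
    fun_prop
  have hx2 : ‖star x * (φ h * x) - star x * φ h - (φ h * x - φ h)‖ < ε := by
    refine lt_of_le_of_lt ((norm_sub_le _ _).trans ?_) hx
    rw [← mul_sub]
    gcongr
    refine (norm_mul_le _ _).trans ?_
    rw [norm_star]
    exact mul_le_of_le_one_left (norm_nonneg _) hx1
  -- The estimate is an open condition on `x`, so it also holds at some point of the dense image of
  -- `A`. No norm bound on `e` is needed.
  obtain ⟨e, he⟩ := hd.exists_mem_open (isOpen_lt hc continuous_const) ⟨x, hx2⟩
  refine ⟨e, ?_⟩
  rw [← hφ]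
  simpa [map_star] using he

end Completion

end CStarSeminorm

/-! ### The seminorms of a pre-Hilbert module -/

section PreHilbert

variable {A : Type u} {E : Type v} [LocallyCStarAlgebra A] [AddCommGroup E] [Module ℂ E]

namespace InnerModule

variable [InnerModule A E]

theorem neg_rsmul (ξ : E) (a : A) : (-ξ) <• a = -(ξ <• a) := by
  rw [← neg_one_smul ℂ ξ, smul_rsmul, neg_one_smul]

theorem sub_rsmul (ξ η : E) (a : A) : (ξ - η) <• a = ξ <• a - η <• a := by
  rw [sub_eq_add_neg, add_rsmul, neg_rsmul, ← sub_eq_add_neg]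

theorem inner_neg_left (ξ η : E) : inner A (-ξ) η = -inner A ξ η := by
  rw [← star_inner, inner_neg_right, star_neg, star_inner]

theorem inner_sub_left (ξ η ζ : E) : inner A (ξ - η) ζ = inner A ξ ζ - inner A η ζ := by
  rw [← star_inner, inner_sub_right, star_sub, star_inner, star_inner]

variable (A) in
theorem parallelogram (ξ η : E) :
    inner A (ξ + η) (ξ + η) + inner A (ξ - η) (ξ - η) =
      (2 : ℂ) • (inner A ξ ξ + inner A η η) := by
  simp only [inner_add_left, inner_add_right, inner_sub_left, inner_sub_right, two_smul]
  abel

/-- Each `x = ⟨ζ, ξ⟩ - ⟨ζ, η⟩` satisfies `x a = 0` for all `a`. The choice `a = x⋆` gives `x x⋆ =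
0`, hence `x = 0`. -/
theorem eq_of_rsmul_eq {ξ η : E} (h : ∀ a : A, ξ <• a = η <• a) : ξ = η := by
  refine ext_inner (A := A) fun ζ => sub_eq_zero.1 ?_
  have h1 (a : A) : (inner A ζ ξ - inner A ζ η) * a = 0 := by
    rw [sub_mul, ← inner_rsmul_right, ← inner_rsmul_right, h, sub_self]
  refine star_eq_zero.1 (star_mul_self_eq_zero' ?_)
  rw [star_star]
  exact h1 _

end InnerModule

namespace PreHilbertModule

variable [PreHilbertModule A E] (p : ContCStarSeminorm A)

/-- Adding the positive element `⟨ξ - η, ξ - η⟩` can only increase `p`, and the parallelogram law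
evaluates the sum. This weak triangle inequality for squared seminorms suffices for limits and takes
the place of Cauchy–Schwarz. -/
theorem sn_inner_add_le (ξ η : E) :
    p.sn (inner A (ξ + η) (ξ + η)) ≤ 2 * (p.sn (inner A ξ ξ) + p.sn (inner A η η)) := by
  obtain ⟨a, ha⟩ := inner_self_nonneg (A := A) (ξ + η)
  obtain ⟨b, hb⟩ := inner_self_nonneg (A := A) (ξ - η)
  have h : p.sn _ ≤ p.sn _ := p.1.map_le_map_add a b
  rw [← ha, ← hb, InnerModule.parallelogram, map_smul_eq_mul, Complex.norm_ofNat] at h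
  exact h.trans (mul_le_mul_of_nonneg_left (map_add_le_add p.sn _ _) zero_le_two)

theorem sn_inner_sub_le (ξ η ζ : E) :
    p.sn (inner A (ξ - ζ) (ξ - ζ)) ≤
      2 * (p.sn (inner A (ξ - η) (ξ - η)) + p.sn (inner A (ζ - η) (ζ - η))) := by
  have h := sn_inner_add_le p (ξ - η) (-(ζ - η))
  rwa [InnerModule.inner_neg_left, InnerModule.inner_neg_right, neg_neg,
    show ξ - η + -(ζ - η) = ξ - ζ by abel] at h

theorem sn_inner_rsmul_le (ξ : E) (a : A) :
    p.sn (inner A (ξ <• a) (ξ <• a)) ≤ p.sn a ^ 2 * p.sn (inner A ξ ξ) := by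
  rw [InnerModule.inner_rsmul_right, InnerModule.inner_rsmul_left]
  have h1 : p.sn (star a * inner A ξ ξ * a) ≤ p.sn (star a * inner A ξ ξ) * p.sn a :=
    p.1.map_mul_le _ _
  have h2 : p.sn (star a * inner A ξ ξ) ≤ p.sn (star a) * p.sn (inner A ξ ξ) := p.1.map_mul_le _ _
  have h3 : p.sn (star a) = p.sn a := p.1.apply_star a
  rw [h3] at h2
  calc _ ≤ _ := h1
    _ ≤ p.sn a * p.sn (inner A ξ ξ) * p.sn a := by gcongr
    _ = _ := by ring

theorem eq_of_sn_inner_sub_eq_zero {ξ η : E}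
    (h : ∀ p : ContCStarSeminorm A, p.sn (inner A (ξ - η) (ξ - η)) = 0) : ξ = η :=
  sub_eq_zero.1 ((InnerModule.inner_self_eq_zero (A := A) _).1 (eq_zero_of_seminorms h))

theorem tendsto_modSeminorm {X : Type*} {l : Filter X} {f : X → E} :
    Tendsto (fun x => modSeminorm p (f x)) l (𝓝 0) ↔
      Tendsto (fun x => p.sn (inner A (f x) (f x))) l (𝓝 0) := by
  constructor
  · intro h
    have h1 := h.pow 2
    simpa [modSeminorm, Real.sq_sqrt (apply_nonneg p.sn _)] using h1
  · intro h
    have h1 := (Real.continuous_sqrt.tendsto 0).comp h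
    rwa [Real.sqrt_zero] at h1

end PreHilbertModule

end PreHilbert

/-! ### Approximate units -/

section ApproxUnit

variable {A : Type u} [LocallyCStarAlgebra A]

/-- Needed for the directed infimum of filters in `exists_approx_filter`. -/
instance : Nonempty (ContCStarSeminorm A) :=
  ⟨⟨⟨0, fun _ _ => (mul_zero (0 : ℝ)).ge, fun _ => (zero_pow two_ne_zero).symm⟩,
    continuous_const⟩⟩

/-- The maximum of two continuous C⋆-seminorms. -/
noncomputable instance : Max (ContCStarSeminorm A) where
  max p q := ⟨⟨p.sn ⊔ q.sn, fun a b => by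
      have hp : p.sn (a * b) ≤ p.sn a * p.sn b := p.1.mul_le' a b
      have hq : q.sn (a * b) ≤ q.sn a * q.sn b := q.1.mul_le' a b
      change max (p.sn (a * b)) (q.sn (a * b)) ≤ max (p.sn a) (q.sn a) * max (p.sn b) (q.sn b)
      refine max_le (hp.trans ?_) (hq.trans ?_)
      · exact mul_le_mul (le_max_left _ _) (le_max_left _ _) (apply_nonneg _ _)
          ((apply_nonneg _ _).trans (le_max_left _ _))
      · exact mul_le_mul (le_max_right _ _) (le_max_right _ _) (apply_nonneg _ _)
          ((apply_nonneg _ _).trans (le_max_right _ _)),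
    fun a => by
      have hp : p.sn (star a * a) = p.sn a ^ 2 := p.1.star_mul_self' a
      have hq : q.sn (star a * a) = q.sn a ^ 2 := q.1.star_mul_self' a
      change max (p.sn (star a * a)) (q.sn (star a * a)) = max (p.sn a) (q.sn a) ^ 2
      rw [hp, hq]
      exact ((pow_left_monotoneOn (n := 2)).map_max (apply_nonneg _ _) (apply_nonneg _ _)).symm⟩,
    p.2.max q.2⟩

theorem ContCStarSeminorm.sn_le_max_left (p q : ContCStarSeminorm A) (a : A) :
    p.sn a ≤ (max p q).sn a :=
  le_max_left (p.sn a) (q.sn a)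

theorem ContCStarSeminorm.sn_le_max_right (p q : ContCStarSeminorm A) (a : A) :
    q.sn a ≤ (max p q).sn a :=
  le_max_right (p.sn a) (q.sn a)

variable {E : Type v} [AddCommGroup E] [Module ℂ E] [InnerModule A E]

theorem InnerModule.exists_sn_rsmul_sub_lt (p : ContCStarSeminorm A) (ξ : E) {ε : ℝ}
    (hε : 0 < ε) : ∃ e : A, p.sn (inner A (ξ <• e - ξ) (ξ <• e - ξ)) < ε := by
  obtain ⟨e, he⟩ := p.1.exists_approx_unit (inner A ξ ξ) hε
  refine ⟨e, ?_⟩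
  simp only [inner_sub_left, inner_sub_right, inner_rsmul_left, inner_rsmul_right]
  exact lt_of_eq_of_lt (congrArg p.sn (by rw [sub_mul, mul_assoc]; abel)) he

/-- Every vector of a module is a limit of its multiples by a net of elements of `A`. -/
theorem InnerModule.exists_approx_filter (A : Type u) [LocallyCStarAlgebra A] [InnerModule A E]
    (ξ : E) : ∃ l : Filter A, l.NeBot ∧ ∀ p : ContCStarSeminorm A,
      Tendsto (fun e : A => p.sn (inner A (ξ <• e - ξ) (ξ <• e - ξ))) l (𝓝 0) := by
  let f (p : ContCStarSeminorm A) (e : A) : ℝ := p.sn (inner A (ξ <• e - ξ) (ξ <• e - ξ))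
  have hf (p q : ContCStarSeminorm A) (h : ∀ a, p.sn a ≤ q.sn a) :
      comap (f q) (𝓝 0) ≤ comap (f p) (𝓝 0) :=
    tendsto_iff_comap.1 (squeeze_zero (fun _ => apply_nonneg _ _) (fun _ => h _) tendsto_comap)
  -- This is the coarsest suited candidate: the largest filter along which every `f p` tends to `0`.
  -- The infimum is directed because maxima of C⋆-seminorms are C⋆-seminorms, so it is proper as
  -- soon as each single seminorm can be made small.
  refine ⟨⨅ p, comap (f p) (𝓝 0), ?_, fun p => tendsto_iff_comap.2 (iInf_le _ p)⟩
  refine iInf_neBot_of_directed' (fun p q => ⟨max p q, hf _ _ (p.sn_le_max_left q),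
    hf _ _ (p.sn_le_max_right q)⟩) fun p => comap_neBot fun s hs => ?_
  obtain ⟨ε, hε, hs⟩ := Metric.mem_nhds_iff.1 hs
  obtain ⟨e, he⟩ := exists_sn_rsmul_sub_lt p ξ hε
  refine ⟨e, hs ?_⟩
  rw [mem_ball_zero_iff, Real.norm_of_nonneg (apply_nonneg _ _)]
  exact he

end ApproxUnit

/-! ### Vectors as elements of the multiplier module -/

section Embedding

variable {A : Type u} {E : Type v} {F : Type w} [LocallyCStarAlgebra A]
  [AddCommGroup E] [Module ℂ E] [AddCommGroup F] [Module ℂ F]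

/-- The element `a ↦ ξ a` of `M(E)`, with adjoint `η ↦ ⟨ξ, η⟩`. -/
def MultiplierModule.ofVector (A : Type u) [LocallyCStarAlgebra A] [InnerModule A E] (ξ : E) :
    MultiplierModule A E :=
  ⟨{ toFun := fun a => ξ <• a
     map_add' := InnerModule.rsmul_add ξ
     map_smul' := fun z a => InnerModule.rsmul_smul z ξ a },
   { toFun := fun η => inner A ξ η
     map_add' := InnerModule.inner_add_right ξ
     map_smul' := fun z η => InnerModule.inner_smul_right z ξ η },
   ⟨InnerModule.rsmul_mul ξ, fun η a => InnerModule.inner_rsmul_right ξ η a,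
    fun a η => InnerModule.inner_rsmul_left ξ η a⟩⟩

theorem MultiplierModule.ofVector_apply [InnerModule A E] (ξ : E) (a : A) :
    (ofVector A ξ).toLin a = ξ <• a := rfl

theorem MultiplierModule.ofVector_injective [InnerModule A E] :
    Function.Injective (ofVector A : E → MultiplierModule A E) := fun _ _ h =>
  InnerModule.eq_of_rsmul_eq (A := A) fun a => congrArg (fun t => Adjointable.toLin t a) h

theorem MultiplierModule.inner_ofVector_l [InnerModule A E] (ξ η : E) (a : A) :
    (inner (Multiplier A) (ofVector A ξ) (ofVector A η)).l a = inner A ξ η * a := by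
  rw [inner_l, ← InnerModule.inner_rsmul_right]
  refine InnerModule.ext_inner (A := A) fun b => ?_
  rw [← Adjointable.inner_toLin, ofVector_apply, ofVector_apply, InnerModule.inner_rsmul_left]
  rfl

theorem MultiplierModule.ofVector_add [InnerModule A E] (ξ η : E) :
    ofVector A (ξ + η) = ofVector A ξ + ofVector A η :=
  Adjointable.ext_apply fun a => InnerModule.add_rsmul ξ η a

theorem MultiplierModule.ofVector_smul [InnerModule A E] (z : ℂ) (ξ : E) :
    ofVector A (z • ξ) = z • ofVector A ξ :=
  Adjointable.ext_apply fun a => InnerModule.smul_rsmul z ξ a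

/-- The multiplier given by left multiplication by an element of `A`. -/
noncomputable def Multiplier.ofElement (a : A) : Multiplier A :=
  (MultiplierModule.ofVector A a).toMultiplier

/-- Expresses the action of `A` on vectors through that of `M(A)`, so that `M(A)`-linear operators
restrict to `A`-linear ones. -/
theorem MultiplierModule.ofVector_rsmul [InnerModule A E] (ξ : E) (a : A) :
    ofVector A (ξ <• a) = ofVector A ξ <• Multiplier.ofElement a :=
  Adjointable.ext_apply fun b => (InnerModule.rsmul_mul ξ a b).symm

open PreHilbertModule in
/-- An element of `M(F)` whose square is given by an element `⟨ξ, ξ⟩` of `A` comes from `F`. -/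
theorem MultiplierModule.exists_eq_ofVector [PreHilbertModule A E] [HilbertModule A F] {ξ : E}
    {t : MultiplierModule A F}
    (h : inner (Multiplier A) t t = inner (Multiplier A) (ofVector A ξ) (ofVector A ξ)) :
    ∃ η : F, t = ofVector A η := by
  -- Both sides equal `⟨a, s⋆ s a⟩`, for `s = t` and `s = ofVector A ξ`, and the two `s⋆ s` agree by
  -- hypothesis.
  have key (a : A) : inner A (t.toLin a) (t.toLin a) = inner A (ξ <• a) (ξ <• a) := by
    have h1 := congrArg (fun m => Multiplier.l m a) h
    simp only [inner_l] at h1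
    rw [Adjointable.inner_toLin, h1, ← Adjointable.inner_toLin, ofVector_apply]
  have key' (a b : A) : inner A (t.toLin a - t.toLin b) (t.toLin a - t.toLin b) =
      inner A (ξ <• a - ξ <• b) (ξ <• a - ξ <• b) := by
    have h1 := key (a - b)
    rw [map_sub, ← ofVector_apply, map_sub] at h1
    exact h1
  obtain ⟨l, _, hl⟩ := InnerModule.exists_approx_filter A ξ
  have hcauchy (p : ContCStarSeminorm A) :
      Tendsto (fun z : F × F => modSeminorm p (z.1 - z.2)) (map t.toLin l ×ˢ map t.toLin l)
        (𝓝 0) := by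
    rw [prod_map_map_eq, tendsto_map'_iff]
    refine (tendsto_modSeminorm p).2 ?_
    have h1 := ((hl p).comp tendsto_fst).add ((hl p).comp (tendsto_snd (f := l) (g := l)))
    have h2 := h1.const_mul 2
    rw [add_zero, mul_zero] at h2
    refine squeeze_zero (fun _ => apply_nonneg _ _) (fun z => ?_) h2
    rw [key']
    exact sn_inner_sub_le p _ ξ _
  obtain ⟨η, hη⟩ := HilbertModule.complete (A := A) (map t.toLin l) inferInstance hcauchy
  refine ⟨η, Adjointable.ext_apply fun a => eq_of_sn_inner_sub_eq_zero (A := A) fun p => ?_⟩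
  -- The bound `2 p(a)² (p⟨ξ e - ξ, ξ e - ξ⟩ + p⟨t e - η, t e - η⟩)` tends to `0`; it will dominate
  -- the squared distance from `t a` to `η a`, which does not depend on `e`.
  have h1 := (((hl p).add ((tendsto_modSeminorm p).1 (tendsto_map'_iff.1 (hη p)))).const_mul
    (p.sn a ^ 2)).const_mul 2
  rw [add_zero, mul_zero, mul_zero] at h1
  refine le_antisymm (ge_of_tendsto' h1 fun e => ?_) (apply_nonneg _ _)
  rw [ofVector_apply]
  -- The intermediate point is `t (e a) = (t e) a`. Its distance to `t a` is that of `ξ e a` to `ξ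
  -- a` by `key'`; its difference from `η a` is a multiple by `a` of `t e - η`.
  refine (sn_inner_sub_le p _ (t.toLin (e * a)) _).trans ?_
  refine mul_le_mul_of_nonneg_left ?_ zero_le_two
  rw [mul_add]
  have hT : t.toLin (e * a) = t.toLin e <• a := t.map_rsmul e a
  have hE : ξ <• (e * a) = (ξ <• e) <• a := InnerModule.rsmul_mul ξ e a
  refine add_le_add ?_ ?_
  · rw [key', hE, ← InnerModule.sub_rsmul, ← neg_sub (ξ <• e) ξ, InnerModule.neg_rsmul,
      InnerModule.inner_neg_left, InnerModule.inner_neg_right, neg_neg]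
    exact sn_inner_rsmul_le p _ a
  · rw [hT, ← InnerModule.sub_rsmul, ← neg_sub (t.toLin e) η, InnerModule.neg_rsmul,
      InnerModule.inner_neg_left, InnerModule.inner_neg_right, neg_neg]
    exact sn_inner_rsmul_le p _ a

/-- The operator `t ↦ u ∘ t` from `M(E)` to `M(F)`. -/
noncomputable def MultiplierModule.map [InnerModule A E] [InnerModule A F]
    (u : Adjointable A E F) :
    Adjointable (Multiplier A) (MultiplierModule A E) (MultiplierModule A F) :=
  ⟨{ toFun := u.comp
     map_add' := fun s t => Adjointable.ext_apply fun a => map_add u.toLin (s.toLin a) (t.toLin a)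
     map_smul' := fun z t => Adjointable.ext_apply fun a => map_smul u.toLin z (t.toLin a) },
   { toFun := u.adjoint.comp
     map_add' := fun s t => Adjointable.ext_apply fun a =>
      map_add u.adjoint.toLin (s.toLin a) (t.toLin a)
     map_smul' := fun z t => Adjointable.ext_apply fun a =>
      map_smul u.adjoint.toLin z (t.toLin a) },
   ⟨fun _ _ => rfl, fun _ _ => rfl, fun s t => Multiplier.ext_l fun a => by
      simp [inner_l, Adjointable.adjoint_comp]⟩⟩

theorem MultiplierModule.map_toLin [InnerModule A E] [InnerModule A F]
    (u : Adjointable A E F) (t : MultiplierModule A E) : (map u).toLin t = u.comp t := rfl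

theorem MultiplierModule.adjoint_map [InnerModule A E] [InnerModule A F]
    (u : Adjointable A E F) : (map u).adjoint = map u.adjoint :=
  Adjointable.adjoint_eq fun s t => Multiplier.ext_l fun a => by
    simp [map_toLin, inner_l, Adjointable.adjoint_comp]

theorem UnitarilyEquivalent.multiplierModule [InnerModule A E] [InnerModule A F]
    (h : UnitarilyEquivalent A E F) :
    UnitarilyEquivalent (Multiplier A) (MultiplierModule A E) (MultiplierModule A F) := by
  obtain ⟨u, h1, h2⟩ := h
  refine ⟨MultiplierModule.map u, ?_, ?_⟩ <;> rw [MultiplierModule.adjoint_map]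
  · refine Adjointable.ext_apply fun t => Adjointable.ext_apply fun a => ?_
    exact congrArg (fun s => Adjointable.toLin s (t.toLin a)) h1
  · refine Adjointable.ext_apply fun t => Adjointable.ext_apply fun a => ?_
    exact congrArg (fun s => Adjointable.toLin s (t.toLin a)) h2

/-! ### Descent of unitaries from multiplier modules to modules -/

theorem MultiplierModule.exists_apply_ofVector [PreHilbertModule A E] [HilbertModule A F]
    {v : Adjointable (Multiplier A) (MultiplierModule A E) (MultiplierModule A F)}
    (hv : v.adjoint.comp v = Adjointable.id _ _) (ξ : E) :
    ∃ η : F, v.toLin (ofVector A ξ) = ofVector A η := by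
  refine exists_eq_ofVector (ξ := ξ) ?_
  rw [Adjointable.inner_toLin, ← Adjointable.comp_apply, hv, Adjointable.id_apply]

theorem MultiplierModule.inner_eq_of_inner_ofVector_eq [InnerModule A E] [InnerModule A F]
    {ξ ξ' : E} {η η' : F} (h : inner (Multiplier A) (ofVector A ξ) (ofVector A ξ') =
      inner (Multiplier A) (ofVector A η) (ofVector A η')) : inner A ξ ξ' = inner A η η' := by
  refine InnerModule.eq_of_rsmul_eq (A := A) fun a => ?_
  have h1 := congrArg (fun m => Multiplier.l m a) h
  simp only [inner_ofVector_l] at h1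
  exact h1

/-- The linear map on vectors induced by an operator that maps vectors to vectors. -/
noncomputable def MultiplierModule.restrict [InnerModule A E] [InnerModule A F]
    (v : MultiplierModule A E →ₗ[ℂ] MultiplierModule A F)
    (h : ∀ ξ : E, ∃ η : F, v (ofVector A ξ) = ofVector A η) : E →ₗ[ℂ] F where
  toFun ξ := (h ξ).choose
  -- The chosen preimage is unique by injectivity of `ofVector`, so linearity may be tested in
  -- `M(F)`.
  map_add' ξ η := ofVector_injective (A := A) <| by
    rw [← (h _).choose_spec, ofVector_add, ofVector_add, map_add, ← (h _).choose_spec,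
      ← (h _).choose_spec]
  map_smul' z ξ := ofVector_injective (A := A) <| by
    rw [← (h _).choose_spec, ofVector_smul, ofVector_smul, map_smul, ← (h _).choose_spec,
      RingHom.id_apply]

theorem MultiplierModule.ofVector_restrict [InnerModule A E] [InnerModule A F]
    {v : MultiplierModule A E →ₗ[ℂ] MultiplierModule A F}
    (h : ∀ ξ : E, ∃ η : F, v (ofVector A ξ) = ofVector A η) (ξ : E) :
    ofVector A (restrict v h ξ) = v (ofVector A ξ) :=
  (h ξ).choose_spec.symm

theorem MultiplierModule.restrict_rsmul [InnerModule A E] [InnerModule A F]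
    (v : Adjointable (Multiplier A) (MultiplierModule A E) (MultiplierModule A F))
    (h : ∀ ξ : E, ∃ η : F, v.toLin (ofVector A ξ) = ofVector A η) (ξ : E) (a : A) :
    restrict v.toLin h (ξ <• a) = restrict v.toLin h ξ <• a :=
  ofVector_injective (A := A) <| by
    rw [ofVector_restrict, ofVector_rsmul, ofVector_rsmul, v.map_rsmul, ofVector_restrict]

open MultiplierModule in
theorem UnitarilyEquivalent.of_multiplierModule [HilbertModule A E] [HilbertModule A F]
    (h : UnitarilyEquivalent (Multiplier A) (MultiplierModule A E) (MultiplierModule A F)) :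
    UnitarilyEquivalent A E F := by
  obtain ⟨v, h1, h2⟩ := h
  have hv (ξ : E) := exists_apply_ofVector (F := F) h1 ξ
  -- The relation `v v⋆ = id` makes `v⋆` isometric as well; here completeness of `E` enters.
  have hw (η : F) := exists_apply_ofVector (F := E) (v := v.adjoint)
    (by rwa [Adjointable.adjoint_adjoint]) η
  have hadj : IsAdjointPair A (restrict v.toLin hv) (restrict v.adjoint.toLin hw) :=
    ⟨restrict_rsmul v hv, restrict_rsmul v.adjoint hw, fun ξ η =>
      inner_eq_of_inner_ofVector_eq <| by
        rw [ofVector_restrict, ofVector_restrict, v.inner_toLin]⟩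
  let u : Adjointable A E F := ⟨restrict v.toLin hv, _, hadj⟩
  -- `adjoint` is defined by choice; uniqueness of adjoints identifies it with the restriction of
  -- `v⋆`.
  have hu : u.adjoint = ⟨restrict v.adjoint.toLin hw, _, Adjointable.isAdjointPair_symm hadj⟩ :=
    Adjointable.adjoint_eq hadj.inner_eq
  refine ⟨u, ?_, ?_⟩ <;> rw [hu] <;> refine Adjointable.ext_apply fun ξ =>
    ofVector_injective (A := A) ?_
  · change ofVector A (restrict v.adjoint.toLin hw (restrict v.toLin hv ξ)) = ofVector A ξ
    rw [ofVector_restrict, ofVector_restrict, ← Adjointable.comp_apply, h1, Adjointable.id_apply]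
  · change ofVector A (restrict v.toLin hv (restrict v.adjoint.toLin hw ξ)) = ofVector A ξ
    rw [ofVector_restrict, ofVector_restrict, ← Adjointable.comp_apply, h2, Adjointable.id_apply]

end Embedding

end LocCStar

/-- Two Hilbert modules over a locally C⋆-algebra `A` are unitarily equivalent iff their
multiplier modules are unitarily equivalent over `M(A)`. -/
theorem corollary4p2 {A : Type*} {E : Type*} {F : Type*} [LocCStar.LocallyCStarAlgebra A]
    [AddCommGroup E] [Module ℂ E] [LocCStar.HilbertModule A E]
    [AddCommGroup F] [Module ℂ F] [LocCStar.HilbertModule A F] :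
    LocCStar.UnitarilyEquivalent A E F ↔
      LocCStar.UnitarilyEquivalent (LocCStar.Multiplier A)
        (LocCStar.MultiplierModule A E) (LocCStar.MultiplierModule A F) :=
  ⟨fun h => h.multiplierModule, fun h => h.of_multiplierModule⟩
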